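/- Let $n\ge 1$ and let $U\subset\mathbb{R}^n$ be a bounded open set with $C^2$ boundary, i.e. for each $x_0\in\partial U$ there is $r>0$ such that, in suitable orthonormal coordinates of $\mathbb{R}^n$, $U\cap B(x_0,r)=\{x\in B(x_0,r): x_n>\gamma(x_1,\dots,x_{n-1})\}$ for some $C^2$ function $\gamma:\mathbb{R}^{n-1}\to\mathbb{R}$. For $\epsilon>0$ let $$U_\epsilon=\{x\in U:\operatorname{dist}(x,\partial U)<\epsilon\}.$$ Then there are constants $\epsilon_0>0$ and $C>0$, depending only on $U$, such that for all $\epsilon\in(0,\epsilon_0)$ and all real-valued $f\in H_0^1(U)$ (the closure of $C_c^\infty(U)$ in $H^1(U)$), with weak gradient $\nabla f$, the function $|f|^2/\operatorname{dist}(\cdot,\partial U)^2$ is integrable on $U_\epsilon$ and $$\int_{U_\epsilon}\frac{|f(x)|^2}{\operatorname{dist}(x,\partial U)^2}\,dx\le C\int_{U_\epsilon}|\nabla f(x)|^2\,dx .$$ In particular $C$ depends neither on $\epsilon$ nor on $f$. -/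

import Mathlib

open MeasureTheory Filter Topology
open scoped ContDiff

namespace BoundaryLayerHardy

/-- Euclidean space `ℝⁿ`. -/
abbrev E (n : ℕ) : Type := EuclideanSpace ℝ (Fin n)

/-- `φ ∈ C_c^∞(U)`: a smooth real function on `ℝⁿ` with compact support contained in `U`. -/
structure IsTestFunction {n : ℕ} (U : Set (E n)) (φ : E n → ℝ) : Prop where
  contDiff : ContDiff ℝ ∞ φ
  hasCompactSupport : HasCompactSupport φ
  tsupport_subset : tsupport φ ⊆ U

/-- `g` is the weak (distributional) gradient of `f` on the open set `U`: both are locally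
integrable on `U`, and `∫_U f ∂ᵢφ = - ∫_U gᵢ φ` for all `φ ∈ C_c^∞(U)` and all `i`. -/
structure HasWeakGradient {n : ℕ} (U : Set (E n)) (f : E n → ℝ) (g : E n → E n) : Prop where
  locallyIntegrableOn : LocallyIntegrableOn f U
  locallyIntegrableOn_gradient : LocallyIntegrableOn g U
  integral_eq : ∀ φ : E n → ℝ, IsTestFunction U φ → ∀ i : Fin n,
    ∫ x in U, f x * fderiv ℝ φ x (EuclideanSpace.single i 1) = - ∫ x in U, g x i * φ x

/-- `f ∈ H¹₀(U)`: `f` is in `H¹(U)`, that is, `f` is in `L²(U)` and has a weak gradient `g` in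
`L²(U)`, and `f` is in the closure of `C_c^∞(U)` for the `H¹(U)` norm, that is, `φₖ → f` and
`∇φₖ → g` in `L²(U)` for some sequence of test functions `φₖ`. -/
def MemH10 {n : ℕ} (U : Set (E n)) (f : E n → ℝ) : Prop :=
  MemLp f 2 (volume.restrict U) ∧
  ∃ g : E n → E n, MemLp g 2 (volume.restrict U) ∧ HasWeakGradient U f g ∧
    ∃ φ : ℕ → E n → ℝ, (∀ k, IsTestFunction U (φ k)) ∧
      Tendsto (fun k => eLpNorm (fun x => φ k x - f x) 2 (volume.restrict U)) atTop (𝓝 0) ∧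
      Tendsto (fun k => eLpNorm (fun x => gradient (φ k) x - g x) 2 (volume.restrict U))
        atTop (𝓝 0)

/-- `U` has `C²` boundary: near each boundary point, in suitable orthonormal coordinates (the
last axis being spanned by the unit vector `ν`, the others spanning `νᗮ`), `U` is the set of
points lying strictly above the graph of a `C²` function `γ` of the first `n - 1` coordinates. -/
def HasC2Boundary {n : ℕ} (U : Set (E n)) : Prop :=
  ∀ x₀ ∈ frontier U, ∃ r > 0, ∃ ν : E n, ‖ν‖ = 1 ∧
    ∃ γ : (Submodule.span ℝ {ν})ᗮ → ℝ, ContDiff ℝ 2 γ ∧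
      U ∩ Metric.ball x₀ r =
        {x ∈ Metric.ball x₀ r |
          γ ((Submodule.span ℝ {ν})ᗮ.orthogonalProjectionOnto x) < inner ℝ ν x}

/-- The boundary layer `U_ε = {x ∈ U : dist(x, ∂U) < ε}`. -/
def boundaryLayer {n : ℕ} (U : Set (E n)) (ε : ℝ) : Set (E n) :=
  {x ∈ U | Metric.infDist x (frontier U) < ε}

end BoundaryLayerHardy

/-!
# A Hardy inequality on boundary layers

Near a boundary point the domain lies above the graph of a function `γ` in the direction of a unit
vector `ν`; let `σ` be the height above that graph. The domain is locally invariant under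
translation by positive multiples of `ν`, so the distance to the boundary is nondecreasing along
`ν` (`infDist_frontier_le_add_smul`). Hence every line in the direction `ν` meets the layer `U_ε`,
inside the chart, in a segment that starts on the boundary, with the same `ε` on both sides of the
inequality. On each such segment the classical inequality `∫ u² / s² ≤ 4 ∫ u'²` holds
(`lintegral_hardy_of_isLowerSet`), whatever the length of the segment. As `γ` is locally Lipschitz,
`σ` is at most a multiple of the distance to the boundary (`abs_height_le_mul_infDist`), and
Fubini's theorem yields the inequality for test functions in the chart
(`exists_nhds_lintegral_hardy`). The charts may overlap, since only an upper bound by the integral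
over all of `U_ε` is wanted: compactness of the boundary and summation over a finite cover give the
inequality on all thin layers (`exists_lintegral_hardy`).

Fatou's lemma extends it to `H¹₀(U)` (`eLpNorm_mul_le_of_tendsto`), and the gradient may be any
weak gradient, since these agree almost everywhere (`HasWeakGradient.ae_eq`).
-/

namespace BoundaryLayerHardy

/-! ### Hardy's inequality on an interval -/

open Set in
/-- Hardy's inequality on `(0, S)`, for functions that vanish near `0`. It follows by integrating
the derivative `2uu'/s - u²/s²` of `u²/s`. -/
lemma lintegral_hardy_Ioo {u u' : ℝ → ℝ} (hu : ∀ s, HasDerivAt u (u' s) s) (hu' : Continuous u')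
    {δ : ℝ} (hδ : 0 < δ) (h0 : ∀ s, 0 < s → s ≤ δ → u s = 0) (S : ℝ) :
    ∫⁻ s in Ioo 0 S, ENNReal.ofReal (u s ^ 2 / s ^ 2) ≤
      4 * ∫⁻ s in Ioo 0 S, ENNReal.ofReal (u' s ^ 2) := by
  have huc : Continuous u := continuous_iff_continuousAt.2 fun s => (hu s).continuousAt
  rcases le_or_gt S δ with hS | hS
  · rw [setLIntegral_congr_fun (g := fun _ => 0) measurableSet_Ioo]
    · simp
    · intro s hs
      simp [h0 s hs.1 (hs.2.le.trans hS)]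
  have hne : ∀ s ∈ uIcc δ S, s ≠ 0 := fun s hs => by
    rw [uIcc_of_le hS.le] at hs; exact (hδ.trans_le hs.1).ne'
  have hq : ContinuousOn (fun s => u s ^ 2 / s ^ 2) (uIcc δ S) :=
    (huc.pow 2).continuousOn.div (continuous_id.pow 2).continuousOn
      fun s hs => pow_ne_zero 2 (hne s hs)
  have hF : ∀ s ∈ uIcc δ S, HasDerivAt (fun s => u s ^ 2 / s)
      (2 * u s * u' s / s - u s ^ 2 / s ^ 2) s := fun s hs => by
    have h := ((hu s).pow 2).div (hasDerivAt_id s) (hne s hs)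
    refine h.congr_deriv ?_
    have := hne s hs
    simp only [Pi.pow_apply, id]
    field_simp
    ring
  have hF' : ContinuousOn (fun s => 2 * u s * u' s / s - u s ^ 2 / s ^ 2) (uIcc δ S) :=
    (((continuous_const.mul huc).mul hu').continuousOn.div continuousOn_id hne).sub hq
  have hftc := intervalIntegral.integral_eq_sub_of_hasDerivAt hF hF'.intervalIntegrable
  have hi1 : IntervalIntegrable (fun s => u s ^ 2 / s ^ 2) volume δ S := hq.intervalIntegrable
  have hi2 : IntervalIntegrable (fun s => u' s ^ 2) volume δ S :=
    (hu'.pow 2).intervalIntegrable _ _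
  -- Since `u²/s` vanishes at `δ`, its derivative has nonnegative integral over `[δ, S]`.
  have hnn : 0 ≤ ∫ s in δ..S, (2 * u s * u' s / s - u s ^ 2 / s ^ 2) := by
    rw [hftc, h0 δ hδ le_rfl]
    have : 0 < S := hδ.trans hS
    simp only [ne_eq, OfNat.ofNat_ne_zero, not_false_eq_true, zero_pow, zero_div, sub_zero]
    positivity
  have hle : ∫ s in δ..S, (2 * u s * u' s / s - u s ^ 2 / s ^ 2) ≤
      ∫ s in δ..S, (2 * u' s ^ 2 - (1 / 2) * (u s ^ 2 / s ^ 2)) := by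
    refine intervalIntegral.integral_mono_on hS.le hF'.intervalIntegrable
      ((hi2.const_mul 2).sub (hi1.const_mul _)) fun s hs => ?_
    have e1 : 2 * u s * u' s / s = 2 * (u s / s) * u' s := by ring
    have e2 : u s ^ 2 / s ^ 2 = (u s / s) ^ 2 := by ring
    rw [e1, e2]
    nlinarith [sq_nonneg (u s / s - 2 * u' s)]
  rw [intervalIntegral.integral_sub (hi2.const_mul 2) (hi1.const_mul _),
    intervalIntegral.integral_const_mul, intervalIntegral.integral_const_mul] at hle
  have key : ∫ s in δ..S, u s ^ 2 / s ^ 2 ≤ 4 * ∫ s in δ..S, u' s ^ 2 := by linarith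
  rw [intervalIntegral.integral_of_le hS.le, intervalIntegral.integral_of_le hS.le] at key
  have hsub : Ioo 0 S ⊆ Ioc 0 δ ∪ Ioc δ S := fun s hs => by
    rcases le_or_gt s δ with h | h
    exacts [Or.inl ⟨hs.1, h⟩, Or.inr ⟨h, hs.2.le⟩]
  calc ∫⁻ s in Ioo 0 S, ENNReal.ofReal (u s ^ 2 / s ^ 2)
      ≤ ∫⁻ s in Ioc 0 δ ∪ Ioc δ S, ENNReal.ofReal (u s ^ 2 / s ^ 2) :=
        lintegral_mono_set hsub
    _ ≤ (∫⁻ s in Ioc 0 δ, ENNReal.ofReal (u s ^ 2 / s ^ 2)) +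
          ∫⁻ s in Ioc δ S, ENNReal.ofReal (u s ^ 2 / s ^ 2) := lintegral_union_le _ _ _
    _ = ∫⁻ s in Ioc δ S, ENNReal.ofReal (u s ^ 2 / s ^ 2) := by
        rw [setLIntegral_congr_fun (g := fun _ => 0) measurableSet_Ioc]
        · simp
        · intro s hs
          simp [h0 s hs.1 hs.2]
    _ = ENNReal.ofReal (∫ s in Ioc δ S, u s ^ 2 / s ^ 2) := by
        rw [ofReal_integral_eq_lintegral_ofReal
          ((intervalIntegrable_iff_integrableOn_Ioc_of_le hS.le).1 hi1)
          (ae_of_all _ fun s => by positivity)]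
    _ ≤ ENNReal.ofReal (4 * ∫ s in Ioc δ S, u' s ^ 2) := ENNReal.ofReal_le_ofReal key
    _ = 4 * ∫⁻ s in Ioc δ S, ENNReal.ofReal (u' s ^ 2) := by
        rw [ENNReal.ofReal_mul (by norm_num), ofReal_integral_eq_lintegral_ofReal
          ((intervalIntegrable_iff_integrableOn_Ioc_of_le hS.le).1 hi2)
          (ae_of_all _ fun s => by positivity)]
        norm_num
    _ = 4 * ∫⁻ s in Ioo δ S, ENNReal.ofReal (u' s ^ 2) := by
        rw [restrict_Ioo_eq_restrict_Ioc]
    _ ≤ 4 * ∫⁻ s in Ioo 0 S, ENNReal.ofReal (u' s ^ 2) := by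
        gcongr

open Set in
/-- Hardy's inequality on a set of positive numbers that, up to its right endpoint, is an
interval `(0, S)`. -/
lemma lintegral_hardy_of_isLowerSet {u u' : ℝ → ℝ} (hu : ∀ s, HasDerivAt u (u' s) s)
    (hu' : Continuous u') {δ : ℝ} (hδ : 0 < δ) (h0 : ∀ s, 0 < s → s ≤ δ → u s = 0)
    {J : Set ℝ} (hJ0 : J ⊆ Ioi 0) (hJb : BddAbove J)
    (hJ : ∀ s ∈ J, ∀ t, 0 < t → t ≤ s → t ∈ J) :
    ∫⁻ s in J, ENNReal.ofReal (u s ^ 2 / s ^ 2) ≤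
      4 * ∫⁻ s in J, ENNReal.ofReal (u' s ^ 2) := by
  rcases J.eq_empty_or_nonempty with rfl | hne
  · simp
  have h1 : J ≤ᵐ[volume] Ioo 0 (sSup J) :=
    (LE.le.eventuallyLE (t := Ioc 0 (sSup J))
      fun s hs => ⟨hJ0 hs, le_csSup hJb hs⟩).trans Ioo_ae_eq_Ioc.symm.le
  have h2 : Ioo 0 (sSup J) ⊆ J := fun t ht => by
    obtain ⟨s, hs, hts⟩ := exists_lt_of_lt_csSup hne ht.2
    exact hJ s hs t ht.1 hts.le
  rw [Measure.restrict_congr_set (h1.antisymm h2.eventuallyLE)]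
  exact lintegral_hardy_Ioo hu hu' hδ h0 _

/-! ### Integration along a direction -/

/-- Fubini along the direction of a unit vector `ν`. The measure on `νᗮ` is an arbitrary Haar
measure, whence the constant `c`; the shift `γ` straightens the graph of `γ`. -/
lemma exists_lintegral_eq_graph_coordinates {n : ℕ} {ν : E n} (hν : ‖ν‖ = 1)
    {γ : (Submodule.span ℝ {ν})ᗮ → ℝ} :
    ∃ c : ENNReal, ∃ μ : Measure (Submodule.span ℝ {ν})ᗮ, ∀ G : E n → ENNReal, Measurable G →
      ∫⁻ x, G x = c * ∫⁻ y, ∫⁻ s : ℝ, G ((y : E n) + (γ y + s) • ν) ∂volume ∂μ := by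
  have hν0 : ν ≠ 0 := fun h => by simp [h] at hν
  let e : ((Submodule.span ℝ {ν})ᗮ × ℝ) ≃ₗ[ℝ] E n :=
    ((LinearEquiv.refl ℝ _).prodCongr (LinearEquiv.toSpanNonzeroSingleton ℝ (E n) ν hν0)).trans
      (Submodule.prodEquivOfIsCompl _ _ (Submodule.isCompl_orthogonal _).symm)
  have he : ∀ p, e p = (p.1 : E n) + p.2 • ν := fun p => by
    simp [e]
  let L := e.toContinuousLinearEquiv
  let μ : Measure (Submodule.span ℝ {ν})ᗮ := Measure.addHaar
  have hH : (Measure.map L (μ.prod volume)).IsAddHaarMeasure := L.isAddHaarMeasure_map _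
  have hc := Measure.isAddLeftInvariant_eq_smul (volume : Measure (E n))
    (Measure.map L (μ.prod volume))
  refine ⟨((volume : Measure (E n)).addHaarScalarFactor (Measure.map L (μ.prod volume)) : NNReal),
    μ, fun G hG => ?_⟩
  conv_lhs => rw [hc]
  rw [lintegral_smul_measure, lintegral_map hG L.continuous.measurable,
    lintegral_prod (fun p => G (L p)) (hG.comp L.continuous.measurable).aemeasurable, ENNReal.smul_def, smul_eq_mul]
  congr 2 with y
  rw [← lintegral_add_left_eq_self (μ := (volume : Measure ℝ)) _ (γ y)]
  exact lintegral_congr fun s => congrArg G (he _)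

/-! ### The distance to the boundary in a graph chart -/

open Metric NNReal

section GraphChart

variable {n : ℕ} {U : Set (E n)} {x₀ : E n} {r : ℝ} {σ : E n → ℝ} {ν : E n}


lemma height_eq_zero_of_mem_frontier (hUo : IsOpen U) (hσ : Continuous σ)
    (hchart : U ∩ ball x₀ r = {x ∈ ball x₀ r | 0 < σ x}) {y : E n} (hy : y ∈ frontier U)
    (hyr : y ∈ ball x₀ r) : σ y = 0 := by
  rw [hUo.frontier_eq] at hy
  have key : ∀ x ∈ ball x₀ r, x ∈ U ↔ 0 < σ x := fun x hx => by
    have := Set.ext_iff.1 hchart x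
    simpa [mem_ball.1 hx] using this
  refine le_antisymm (not_lt.1 fun h => hy.2 ((key y hyr).2 h)) (not_lt.1 fun h => ?_)
  obtain ⟨z, ⟨hz1, hz2⟩, hzU⟩ := mem_closure_iff.1 hy.1 (ball x₀ r ∩ {x | σ x < 0})
    (isOpen_ball.inter (isOpen_lt hσ continuous_const)) ⟨hyr, h⟩
  exact lt_asymm hz2 ((key z hz1).1 hzU)

/-- The distance to the boundary is nondecreasing in the direction `ν`: if a point of `∂U` were
closer to `x + δ • ν` than `∂U` is to `x`, its translate by `-δ • ν` would lie outside `U`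
although it lies in a ball around `x` that does not meet `∂U`. -/
lemma infDist_frontier_le_add_smul (hUo : IsOpen U) (hσ : Continuous σ)
    (hchart : U ∩ ball x₀ r = {x ∈ ball x₀ r | 0 < σ x}) (hx₀ : x₀ ∈ frontier U)
    (hν : ‖ν‖ = 1) (hσν : ∀ x t, σ (x + t • ν) = σ x + t) {x : E n} {δ : ℝ} (hδ : 0 ≤ δ)
    (hx : x ∈ ball x₀ (r / 4)) (hxδ : x + δ • ν ∈ ball x₀ (r / 4)) (hpos : 0 < σ x) :
    infDist x (frontier U) ≤ infDist (x + δ • ν) (frontier U) := by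
  have hr : 0 < r := by linarith [pos_of_mem_ball hx]
  by_contra! hlt
  obtain ⟨y, hy, hyd⟩ := (infDist_lt_iff ⟨x₀, hx₀⟩).1 hlt
  have hd : infDist x (frontier U) < r / 4 :=
    (infDist_le_dist_of_mem hx₀).trans_lt hx
  have hyr : y ∈ ball x₀ r := by
    have := dist_triangle_left y x₀ (x + δ • ν)
    have := mem_ball.1 hxδ
    rw [mem_ball]; linarith
  have hδr : δ < r / 2 := by
    have h1 : dist (x + δ • ν) x = δ := by simp [dist_eq_norm, norm_smul, hν, abs_of_nonneg hδ]
    have h2 := dist_triangle_right (x + δ • ν) x x₀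
    have := mem_ball.1 hx
    have := mem_ball.1 hxδ
    linarith
  set z := y - δ • ν with hz
  have hzx : dist z x = dist (x + δ • ν) y := by
    rw [dist_comm (x + δ • ν), dist_eq_norm, dist_eq_norm]; congr 1; rw [hz]; abel
  have hzr : z ∈ ball x₀ r := by
    have := dist_triangle z x x₀
    have := mem_ball.1 hx
    rw [mem_ball]; linarith
  have hσz : σ z ≤ 0 := by
    have := hσν z δ
    rw [hz, sub_add_cancel, height_eq_zero_of_mem_frontier hUo hσ hchart hy hyr, ← hz] at this
    linarith
  have hzU : z ∉ U := fun h =>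
    not_lt.2 hσz (hchart.subset ⟨h, hzr⟩ : z ∈ {x ∈ ball x₀ r | 0 < σ x}).2
  have hxU : x ∈ U :=
    (hchart.symm.subset ⟨ball_subset_ball (by linarith) hx, hpos⟩ : x ∈ U ∩ ball x₀ r).1
  have hxB : x ∈ ball x (infDist x (frontier U)) :=
    mem_ball_self (dist_nonneg.trans_lt hyd)
  have hzB : z ∈ ball x (infDist x (frontier U)) := by rwa [mem_ball, hzx]
  have hsub : ball x (infDist x (frontier U)) ⊆ U ∪ (closure U)ᶜ := fun w hw => by
    by_contra h
    simp only [Set.mem_union, Set.mem_compl_iff, not_or, not_not] at h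
    exact Set.disjoint_left.1 disjoint_ball_infDist hw (hUo.frontier_eq ▸ ⟨h.2, h.1⟩)
  exact hzU ((convex_ball _ _).isPreconnected.subset_left_of_subset_union hUo
    isClosed_closure.isOpen_compl (Set.disjoint_compl_right_iff_subset.2 subset_closure)
    hsub ⟨x, hxB, hxU⟩ hzB)

/-- The height above the graph is at most a multiple of the distance to the boundary: the nearest
boundary point lies in the chart, at height `0`. -/
lemma abs_height_le_mul_infDist (hUo : IsOpen U) (hσ : Continuous σ)
    (hchart : U ∩ ball x₀ r = {x ∈ ball x₀ r | 0 < σ x}) (hx₀ : x₀ ∈ frontier U)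
    {M : ℝ} (hM : ∀ x ∈ ball x₀ r, ∀ y ∈ ball x₀ r, |σ x - σ y| ≤ M * dist x y)
    {x : E n} (hx : x ∈ ball x₀ (r / 4)) : |σ x| ≤ M * infDist x (frontier U) := by
  have hr : 0 < r := by linarith [pos_of_mem_ball hx]
  obtain ⟨y, hy, hyd⟩ := isClosed_frontier.exists_infDist_eq_dist ⟨x₀, hx₀⟩ x
  have hd : infDist x (frontier U) ≤ dist x x₀ := infDist_le_dist_of_mem hx₀
  have hyr : y ∈ ball x₀ r := by
    have := dist_triangle_left y x₀ x
    have := mem_ball.1 hx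
    rw [mem_ball]; linarith
  have := hM x (ball_subset_ball (by linarith) hx) y hyr
  rwa [height_eq_zero_of_mem_frontier hUo hσ hchart hy hyr, sub_zero, ← hyd] at this

end GraphChart

/-! ### The inequality for test functions -/

/-- The Hardy inequality on the part of the boundary layer that lies in a small enough graph
chart. In such a chart the layer is a union of segments in the direction `ν` that start on `∂U`
(`infDist_frontier_le_add_smul`), and the height above the graph is comparable to the distance to
the boundary, so that the inequality follows from the one on an interval. -/
lemma exists_nhds_lintegral_hardy {n : ℕ} {U : Set (E n)} (hUo : IsOpen U)
    (hU2 : HasC2Boundary U) {x₀ : E n} (hx₀ : x₀ ∈ frontier U) :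
    ∃ N : Set (E n), IsOpen N ∧ x₀ ∈ N ∧ ∃ C : ℝ≥0, ∀ ε : ℝ, ∀ φ : E n → ℝ, IsTestFunction U φ →
      ∫⁻ x in N ∩ boundaryLayer U ε, ENNReal.ofReal (φ x ^ 2 / infDist x (frontier U) ^ 2) ≤
        C * ∫⁻ x in boundaryLayer U ε, ENNReal.ofReal (‖gradient φ x‖ ^ 2) := by
  obtain ⟨r, hr, ν, hν, γ, hγ, hchart⟩ := hU2 x₀ hx₀
  set P := (Submodule.span ℝ {ν})ᗮ.orthogonalProjectionOnto with hP
  have hνν : inner ℝ ν ν = 1 := by rw [real_inner_self_eq_norm_sq, hν, one_pow]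
  have hPν : P ν = 0 := Submodule.orthogonalProjectionOnto_orthogonalComplement_singleton_eq_zero ν
  -- `σ` is the height above the graph.
  set σ : E n → ℝ := fun x => inner ℝ ν x - γ (P x) with hσdef
  have hσ : Continuous σ := (continuous_const.inner continuous_id).sub
    (hγ.continuous.comp P.continuous)
  have hσν : ∀ x t, σ (x + t • ν) = σ x + t := fun x t => by
    simp only [hσdef, inner_add_right, inner_smul_right, map_add, map_smul, hPν, hνν, smul_zero,
      add_zero, mul_one]
    ring
  have hXP : ∀ (y : (Submodule.span ℝ {ν})ᗮ) (t : ℝ), P ((y : E n) + t • ν) = y := fun y t => by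
    rw [map_add, map_smul, hPν, smul_zero, add_zero, hP,
      Submodule.orthogonalProjectionOnto_mem_subspace_eq_self]
  have hXσ : ∀ (y : (Submodule.span ℝ {ν})ᗮ) (s : ℝ), σ ((y : E n) + (γ y + s) • ν) = s :=
    fun y s => by
    have h0 : inner ℝ ν (y : E n) = 0 := Submodule.mem_orthogonal_singleton_iff_inner_right.1 y.2
    simp only [hσdef, hXP, inner_add_right, inner_smul_right, hνν, h0]
    ring
  have hdist : ∀ x y : E n, dist (P x) (P y) ≤ dist x y := fun x y => by
    rw [dist_eq_norm, dist_eq_norm, ← map_sub]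
    exact Submodule.norm_orthogonalProjectionOnto_apply_le _ _
  obtain ⟨K, t, ht, hK⟩ := ((hγ.of_le one_le_two).contDiffAt (x := P x₀)).exists_lipschitzOnWith
  obtain ⟨r₁, hr₁, hrt⟩ := Metric.mem_nhds_iff.1 ht
  set R := min r r₁
  have hR : 0 < R := lt_min hr hr₁
  have hchartR : U ∩ ball x₀ R = {x ∈ ball x₀ R | 0 < σ x} := by
    ext x
    have h := Set.ext_iff.1 hchart x
    have hRr : ball x₀ R ⊆ ball x₀ r := ball_subset_ball (min_le_left _ _)
    constructor
    · rintro ⟨hxU, hx⟩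
      exact ⟨hx, sub_pos.2 (h.1 ⟨hxU, hRr hx⟩).2⟩
    · rintro ⟨hx, hpos⟩
      exact ⟨(h.2 ⟨hRr hx, sub_pos.1 hpos⟩).1, hx⟩
  have hlipγ : ∀ x y, P x ∈ ball (P x₀) R → P y ∈ ball (P x₀) R →
      |γ (P x) - γ (P y)| ≤ K * dist (P x) (P y) := fun x y hx hy => by
    have hsub : ball (P x₀) R ⊆ t := (ball_subset_ball (min_le_right _ _)).trans hrt
    simpa [Real.dist_eq] using hK.dist_le_mul _ (hsub hx) _ (hsub hy)
  have hM : ∀ x ∈ ball x₀ R, ∀ y ∈ ball x₀ R, |σ x - σ y| ≤ (1 + K) * dist x y := by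
    intro x hx y hy
    have h1 := hlipγ x y ((hdist _ _).trans_lt hx) ((hdist _ _).trans_lt hy)
    have h2 : |inner ℝ ν x - inner ℝ ν y| ≤ dist x y := by
      rw [← inner_sub_right, dist_eq_norm]
      simpa [hν] using abs_real_inner_le_norm ν (x - y)
    have h3 : (K : ℝ) * dist (P x) (P y) ≤ K * dist x y := by gcongr; exact hdist x y
    have h4 : σ x - σ y = (inner ℝ ν x - inner ℝ ν y) - (γ (P x) - γ (P y)) := by
      simp only [hσdef]; ring
    rw [h4]
    have := abs_sub (inner ℝ ν x - inner ℝ ν y) (γ (P x) - γ (P y))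
    linarith
  have hσ0 : σ x₀ = 0 :=
    height_eq_zero_of_mem_frontier hUo hσ hchartR hx₀ (mem_ball_self hR)
  -- The radius is chosen so that the cylinder `N` lies in the ball of radius `R / 4`.
  set ρ : ℝ := R / (8 * (2 + K)) with hρ
  have hK0 : (0 : ℝ) ≤ K := K.2
  have hρ0 : 0 < ρ := by positivity
  have hρR : (2 + K) * ρ = R / 8 := by rw [hρ]; field_simp
  set N : Set (E n) := {x | dist (P x) (P x₀) < ρ} ∩ {x | |σ x| < ρ} with hN
  have hNo : IsOpen N := (isOpen_lt (P.continuous.dist continuous_const) continuous_const).inter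
    (isOpen_lt hσ.abs continuous_const)
  have hNball : N ⊆ ball x₀ (R / 4) := by
    rintro x ⟨hx1, hx2⟩
    simp only [Set.mem_ofPred_eq] at hx1 hx2
    have hρ' : ρ < R := by nlinarith
    have h1 := hlipγ x x₀ (hx1.trans hρ') (mem_ball_self hR)
    have h2 : inner ℝ ν (x - x₀) = σ x + (γ (P x) - γ (P x₀)) := by
      have : σ x = σ x - σ x₀ := by rw [hσ0, sub_zero]
      rw [this, inner_sub_right]; simp only [hσdef]; ring
    have h3 : x - x₀ = (inner ℝ ν (x - x₀)) • ν + ((P (x - x₀) : _) : E n) := by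
      conv_lhs => rw [← (Submodule.span ℝ {ν}).starProjection_add_starProjection_orthogonal
        (x - x₀), Submodule.starProjection_unit_singleton ℝ hν]
      rfl
    have h4 : ‖x - x₀‖ ≤ |inner ℝ ν (x - x₀)| + dist (P x) (P x₀) := by
      conv_lhs => rw [h3]
      refine (norm_add_le _ _).trans ?_
      rw [norm_smul, hν, mul_one, Real.norm_eq_abs, ← Submodule.coe_norm, map_sub, dist_eq_norm]
    have h5 := abs_add_le (σ x) (γ (P x) - γ (P x₀))
    rw [← h2] at h5
    have h6 : (K : ℝ) * dist (P x) (P x₀) ≤ K * ρ := by gcongr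
    rw [mem_ball, dist_eq_norm]
    linarith
  have hball4 : ball x₀ (R / 4) ⊆ ball x₀ R := ball_subset_ball (by linarith)
  obtain ⟨c, μ, hfub⟩ := exists_lintegral_eq_graph_coordinates hν (γ := γ)
  refine ⟨N, hNo, ⟨by simpa using hρ0, by simpa [hσ0] using hρ0⟩, 4 * (1 + K) ^ 2, ?_⟩
  intro ε φ hφ
  have hφ1 : ContDiff ℝ 1 φ := hφ.contDiff.of_le (by exact_mod_cast le_top)
  have hφd : Differentiable ℝ φ := hφ1.differentiable one_ne_zero
  have hφc : Continuous φ := hφ1.continuous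
  have hφ'c : Continuous (fderiv ℝ φ) := hφ1.continuous_fderiv one_ne_zero
  have hgrad : Continuous (gradient φ) :=
    (InnerProductSpace.toDual ℝ (E n)).symm.continuous.comp hφ'c
  set W : Set (E n) := N ∩ {x | 0 < σ x} ∩ {x | infDist x (frontier U) < ε} with hW
  have hWo : IsOpen W := (hNo.inter (isOpen_lt continuous_const hσ)).inter
    (isOpen_lt (continuous_infDist_pt _) continuous_const)
  have hNW : N ∩ boundaryLayer U ε ⊆ W := fun x hx =>
    ⟨⟨hx.1, (hchartR.subset ⟨hx.2.1, hball4 (hNball hx.1)⟩ :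
      x ∈ {x ∈ ball x₀ R | 0 < σ x}).2⟩, hx.2.2⟩
  have hWU : W ⊆ boundaryLayer U ε := fun x hx =>
    ⟨(hchartR.symm.subset ⟨hball4 (hNball hx.1.1), hx.1.2⟩ : x ∈ U ∩ ball x₀ R).1, hx.2⟩
  have hφσ : Measurable fun x => ENNReal.ofReal ((1 + K) ^ 2 * (φ x ^ 2 / σ x ^ 2)) :=
    ((((hφc.measurable.pow_const 2).div (hσ.measurable.pow_const 2)).const_mul _)).ennreal_ofReal
  have hgm : Measurable fun x => ENNReal.ofReal (‖gradient φ x‖ ^ 2) :=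
    (hgrad.norm.pow 2).measurable.ennreal_ofReal
  -- The inequality on the line through `y` in the direction `ν`.
  have hline : ∀ y : (Submodule.span ℝ {ν})ᗮ,
      ∫⁻ s : ℝ, W.indicator (fun x => ENNReal.ofReal ((1 + K) ^ 2 * (φ x ^ 2 / σ x ^ 2)))
        ((y : E n) + (γ y + s) • ν) ≤
      (4 * (1 + K) ^ 2 : ℝ≥0) * ∫⁻ s : ℝ, W.indicator
        (fun x => ENNReal.ofReal (‖gradient φ x‖ ^ 2)) ((y : E n) + (γ y + s) • ν) := by
    intro y
    set X : ℝ → E n := fun s => (y : E n) + (γ y + s) • ν with hX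
    have hXd : ∀ s, HasDerivAt X ν s := fun s => by
      simpa [hX] using (((hasDerivAt_id s).const_add (γ y)).smul_const ν).const_add (y : E n)
    have hXc : Continuous X := continuous_iff_continuousAt.2 fun s => (hXd s).continuousAt
    set J : Set ℝ := X ⁻¹' W with hJ
    have hJm : MeasurableSet J := (hWo.preimage hXc).measurableSet
    have hi : ∀ G : E n → ENNReal, ∫⁻ s, W.indicator G (X s) = ∫⁻ s in J, G (X s) := fun G => by
      rw [← lintegral_indicator hJm]; rfl
    rw [hi, hi]
    rcases J.eq_empty_or_nonempty with hJe | ⟨s₀, hs₀⟩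
    · simp [hJe]
    have hy : dist y (P x₀) < ρ := by
      have : dist (P (X s₀)) (P x₀) < ρ := hs₀.1.1.1
      rwa [hX, hXP] at this
    have hJpos : ∀ s ∈ J, 0 < s := fun s hs => by
      have : 0 < σ (X s) := hs.1.2
      rwa [hX, hXσ] at this
    have hJlt : ∀ s ∈ J, s < ρ := fun s hs => by
      have : |σ (X s)| < ρ := hs.1.1.2
      rw [hX, hXσ] at this
      exact (le_abs_self s).trans_lt this
    have hXN : ∀ s, 0 ≤ s → s < ρ → X s ∈ N := fun s h0 h1 => by
      refine ⟨?_, ?_⟩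
      · simp only [Set.mem_ofPred_eq, hX, hXP]; exact hy
      · simp only [Set.mem_ofPred_eq, hX, hXσ]; rwa [abs_of_nonneg h0]
    have hlow : ∀ s ∈ J, ∀ t, 0 < t → t ≤ s → t ∈ J := fun s hs t h0 hts => by
      have htN := hXN t h0.le (hts.trans_lt (hJlt s hs))
      have hst : X s = X t + (s - t) • ν := by
        simp only [hX]; module
      have hXt : 0 < σ (X t) := by rw [hX, hXσ]; exact h0
      refine ⟨⟨htN, hXt⟩, ?_⟩
      have := infDist_frontier_le_add_smul hUo hσ hchartR hx₀ hν hσν (sub_nonneg.2 hts)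
        (hNball htN) (hst ▸ hNball hs.1.1) hXt
      rw [← hst] at this
      exact this.trans_lt hs.2
    have hX0 : X 0 ∉ tsupport φ := fun h => by
      have h1 := hφ.tsupport_subset h
      have h2 : 0 < σ (X 0) := (hchartR.subset ⟨h1, hball4 (hNball (hXN 0 le_rfl hρ0))⟩ :
        X 0 ∈ {x ∈ ball x₀ R | 0 < σ x}).2
      rw [hX, hXσ] at h2
      exact lt_irrefl _ h2
    obtain ⟨δ, hδ, hδ'⟩ := Metric.isOpen_iff.1
      ((isClosed_tsupport φ).isOpen_compl.preimage hXc) 0 hX0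
    have hvan : ∀ s, 0 < s → s ≤ δ / 2 → φ (X s) = 0 := fun s h0 h1 =>
      image_eq_zero_of_notMem_tsupport (hδ' (by
        rw [mem_ball, Real.dist_eq, sub_zero, abs_of_pos h0]; linarith))
    have hhardy := lintegral_hardy_of_isLowerSet (u := fun s => φ (X s))
      (u' := fun s => fderiv ℝ φ (X s) ν)
      (fun s => (hφd (X s)).hasFDerivAt.comp_hasDerivAt s (hXd s))
      ((hφ'c.comp hXc).clm_apply continuous_const) (half_pos hδ) hvan
      (fun s hs => hJpos s hs) ⟨ρ, fun s hs => (hJlt s hs).le⟩ hlow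
    calc ∫⁻ s in J, ENNReal.ofReal ((1 + K) ^ 2 * (φ (X s) ^ 2 / σ (X s) ^ 2))
        = ((1 + K) ^ 2 : ℝ≥0) * ∫⁻ s in J, ENNReal.ofReal (φ (X s) ^ 2 / s ^ 2) := by
          rw [← lintegral_const_mul' _ _ ENNReal.coe_ne_top]
          refine lintegral_congr fun s => ?_
          have : σ (X s) = s := hXσ y s
          rw [this, ENNReal.ofReal_mul (by positivity)]
          congr 1
          rw [← ENNReal.ofReal_coe_nnreal]; push_cast; rfl
      _ ≤ ((1 + K) ^ 2 : ℝ≥0) *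
            (4 * ∫⁻ s in J, ENNReal.ofReal ((fderiv ℝ φ (X s) ν) ^ 2)) := by gcongr
      _ ≤ ((1 + K) ^ 2 : ℝ≥0) *
            (4 * ∫⁻ s in J, ENNReal.ofReal (‖gradient φ (X s)‖ ^ 2)) := by
          gcongr _ * (_ * ?_)
          refine lintegral_mono fun s => ENNReal.ofReal_le_ofReal ?_
          rw [← sq_abs]
          refine pow_le_pow_left₀ (abs_nonneg _) ?_ 2
          have h1 := (fderiv ℝ φ (X s)).le_opNorm ν
          rw [hν, mul_one, Real.norm_eq_abs] at h1
          simpa [gradient] using h1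
      _ = _ := by
          rw [← mul_assoc]; congr 1; push_cast; ring
  calc ∫⁻ x in N ∩ boundaryLayer U ε, ENNReal.ofReal (φ x ^ 2 / infDist x (frontier U) ^ 2)
      ≤ ∫⁻ x in W, ENNReal.ofReal (φ x ^ 2 / infDist x (frontier U) ^ 2) :=
        lintegral_mono_set hNW
    _ ≤ ∫⁻ x in W, ENNReal.ofReal ((1 + K) ^ 2 * (φ x ^ 2 / σ x ^ 2)) := by
        refine setLIntegral_mono' hWo.measurableSet fun x hx => ENNReal.ofReal_le_ofReal ?_
        have h1 := abs_height_le_mul_infDist hUo hσ hchartR hx₀ hM (hNball hx.1.1)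
        have hpos : 0 < σ x := hx.1.2
        rw [abs_of_pos hpos] at h1
        have hd : 0 < infDist x (frontier U) :=
          pos_of_mul_pos_right (hpos.trans_le h1) (by positivity)
        rw [← mul_div_assoc, div_le_div_iff₀ (by positivity) (by positivity)]
        have := pow_le_pow_left₀ hpos.le h1 2
        rw [mul_pow] at this
        nlinarith [sq_nonneg (φ x)]
    _ = ∫⁻ x, W.indicator (fun x => ENNReal.ofReal ((1 + K) ^ 2 * (φ x ^ 2 / σ x ^ 2))) x :=
        (lintegral_indicator hWo.measurableSet _).symm
    _ = c * ∫⁻ y, ∫⁻ s : ℝ, W.indicator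
          (fun x => ENNReal.ofReal ((1 + K) ^ 2 * (φ x ^ 2 / σ x ^ 2)))
          ((y : E n) + (γ y + s) • ν) ∂volume ∂μ := hfub _ (hφσ.indicator hWo.measurableSet)
    _ ≤ c * ∫⁻ y, (4 * (1 + K) ^ 2 : ℝ≥0) * ∫⁻ s : ℝ, W.indicator
          (fun x => ENNReal.ofReal (‖gradient φ x‖ ^ 2))
          ((y : E n) + (γ y + s) • ν) ∂volume ∂μ := by
        gcongr with y
        exact hline y
    _ = (4 * (1 + K) ^ 2 : ℝ≥0) * ∫⁻ x, W.indicator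
          (fun x => ENNReal.ofReal (‖gradient φ x‖ ^ 2)) x := by
        rw [hfub _ (hgm.indicator hWo.measurableSet), lintegral_const_mul' _ _ ENNReal.coe_ne_top,
          mul_left_comm]
    _ = (4 * (1 + K) ^ 2 : ℝ≥0) * ∫⁻ x in W, ENNReal.ofReal (‖gradient φ x‖ ^ 2) := by
        rw [lintegral_indicator hWo.measurableSet]
    _ ≤ _ := by gcongr

/-- The Hardy inequality on thin boundary layers for test functions: finitely many of the
neighbourhoods of `exists_nhds_lintegral_hardy` cover `∂U`, hence also every thin enough layer. -/
lemma exists_lintegral_hardy {n : ℕ} (hn : 1 ≤ n) {U : Set (E n)} (hUo : IsOpen U)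
    (hUb : Bornology.IsBounded U) (hU2 : HasC2Boundary U) :
    ∃ ε₀ : ℝ, 0 < ε₀ ∧ ∃ C : ℝ≥0, ∀ ε : ℝ, ε < ε₀ → ∀ φ : E n → ℝ, IsTestFunction U φ →
      ∫⁻ x in boundaryLayer U ε, ENNReal.ofReal (φ x ^ 2 / infDist x (frontier U) ^ 2) ≤
        C * ∫⁻ x in boundaryLayer U ε, ENNReal.ofReal (‖gradient φ x‖ ^ 2) := by
  rcases (frontier U).eq_empty_or_nonempty with hF | hF
  · -- A bounded set without boundary is empty, as the space is unbounded for `1 ≤ n`.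
    have : Nonempty (Fin n) := ⟨⟨0, hn⟩⟩
    have hU : U = ∅ := by
      rcases frontier_eq_empty_iff.1 hF with h | h
      · exact h
      · exact absurd (h ▸ hUb) (NormedSpace.unbounded_univ ℝ (E n))
    refine ⟨1, one_pos, 1, fun ε _ φ _ => ?_⟩
    have : boundaryLayer U ε = ∅ := by simp [boundaryLayer, hU]
    simp [this]
  choose! N hNo hxN C hC using fun x₀ hx₀ => exists_nhds_lintegral_hardy hUo hU2 (x₀ := x₀) hx₀
  have hcomp : IsCompact (frontier U) := isCompact_of_isClosed_isBounded isClosed_frontier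
    (hUb.closure.subset frontier_subset_closure)
  obtain ⟨t, htF, ht⟩ := hcomp.elim_nhds_subcover N fun x hx => (hNo x hx).mem_nhds (hxN x hx)
  obtain ⟨δ, hδ, hδN⟩ := hcomp.exists_thickening_subset_open
    (isOpen_biUnion fun x hx => hNo x (htF x hx)) ht
  refine ⟨δ, hδ, ∑ x ∈ t, C x, fun ε hε φ hφ => ?_⟩
  have hcover : boundaryLayer U ε ⊆ ⋃ x : t, N x ∩ boundaryLayer U ε := fun x hx => by
    have := hδN (mem_thickening_iff.2 ((infDist_lt_iff hF).1 (hx.2.trans hε)))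
    simp only [Set.mem_iUnion] at this
    obtain ⟨y, hy, hxy⟩ := this
    exact Set.mem_iUnion.2 ⟨⟨y, hy⟩, hxy, hx⟩
  calc _ ≤ ∫⁻ x in ⋃ x : t, N x ∩ boundaryLayer U ε,
          ENNReal.ofReal (φ x ^ 2 / infDist x (frontier U) ^ 2) := lintegral_mono_set hcover
    _ ≤ ∑' y : t, ∫⁻ x in N y ∩ boundaryLayer U ε,
          ENNReal.ofReal (φ x ^ 2 / infDist x (frontier U) ^ 2) := lintegral_iUnion_le _ _
    _ ≤ ∑' y : t, C y * ∫⁻ x in boundaryLayer U ε, ENNReal.ofReal (‖gradient φ x‖ ^ 2) :=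
        ENNReal.tsum_le_tsum fun y => hC y (htF y y.2) ε φ hφ
    _ = _ := by
        rw [tsum_fintype, ← Finset.sum_mul, ENNReal.ofNNReal_finsetSum,
          Finset.sum_coe_sort t fun x => (C x : ENNReal)]

/-! ### From test functions to `H¹₀` -/

lemma eLpNorm_two_pow_two {α F : Type*} [MeasurableSpace α] [NormedAddCommGroup F] (f : α → F)
    (μ : Measure α) : eLpNorm f 2 μ ^ 2 = ∫⁻ x, ENNReal.ofReal (‖f x‖ ^ 2) ∂μ := by
  have h := eLpNorm_nnreal_pow_eq_lintegral (f := f) (μ := μ) (p := 2) two_ne_zero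
  simp only [NNReal.coe_ofNat, ENNReal.rpow_ofNat, ENNReal.coe_ofNat] at h
  rw [h]
  refine lintegral_congr fun x => ?_
  rw [ENNReal.ofReal_pow (norm_nonneg _), ofReal_norm]

/-- Weak gradients are unique up to null sets. -/
lemma HasWeakGradient.ae_eq {n : ℕ} {U : Set (E n)} (hUo : IsOpen U) {f : E n → ℝ}
    {g g' : E n → E n} (hg : HasWeakGradient U f g) (hg' : HasWeakGradient U f g') :
    g =ᵐ[volume.restrict U] g' := by
  have key : ∀ᵐ x, x ∈ U → (g - g') x = 0 := by
    refine hUo.ae_eq_zero_of_integral_contDiff_smul_eq_zero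
      (hg.locallyIntegrableOn_gradient.sub hg'.locallyIntegrableOn_gradient)
      fun φ h1 h2 h3 => ?_
    have hint : ∀ {k : E n → E n}, LocallyIntegrableOn k U →
        Integrable (fun x => φ x • k x) (volume.restrict U) := fun {k} hk => by
      have hK : IntegrableOn (fun x => φ x • k x) (tsupport φ) :=
        (hk.integrableOn_compact_subset h3 h2).continuousOn_smul h1.continuous.continuousOn h2
      refine ((integrableOn_iff_integrable_of_support_subset fun x hx => ?_).1 hK).integrableOn
      exact subset_tsupport φ fun h0 => hx (by simp [h0])
    have hset : ∫ x, φ x • (g - g') x = ∫ x in U, φ x • (g - g') x :=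
      (setIntegral_eq_integral_of_forall_compl_eq_zero fun x hx => by
        rw [image_eq_zero_of_notMem_tsupport fun h => hx (h3 h), zero_smul]).symm
    rw [hset]
    simp only [Pi.sub_apply, smul_sub]
    rw [integral_sub (hint hg.locallyIntegrableOn_gradient)
      (hint hg'.locallyIntegrableOn_gradient), sub_eq_zero]
    ext i
    have hproj : ∀ {k : E n → E n}, LocallyIntegrableOn k U →
        (∫ x in U, φ x • k x) i = ∫ x in U, k x i * φ x := fun {k} hk => by
      have := (EuclideanSpace.proj i : E n →L[ℝ] ℝ).integral_comp_comm (hint hk)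
      refine this.symm.trans ?_
      refine integral_congr_ae (ae_of_all _ fun x => ?_)
      simp [mul_comm]
    rw [hproj hg.locallyIntegrableOn_gradient, hproj hg'.locallyIntegrableOn_gradient]
    have e1 := hg.integral_eq φ ⟨h1, h2, h3⟩ i
    have e2 := hg'.integral_eq φ ⟨h1, h2, h3⟩ i
    linarith
  rw [Filter.EventuallyEq, ae_restrict_iff' hUo.measurableSet]
  filter_upwards [key] with x hx hxU
  exact sub_eq_zero.1 (hx hxU)

/-- A Hardy inequality for a weight `w` passes from a sequence of functions to its limit in the
`H¹` norm, by Fatou's lemma along an almost everywhere convergent subsequence. -/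
lemma eLpNorm_mul_le_of_tendsto {α F : Type*} [MeasurableSpace α] [NormedAddCommGroup F]
    {μ : Measure α} {w f : α → ℝ} {g : α → F} {φ : ℕ → α → ℝ} {ψ : ℕ → α → F} {C : ℝ≥0}
    (hw : AEStronglyMeasurable w μ) (hf : AEStronglyMeasurable f μ)
    (hg : AEStronglyMeasurable g μ) (hφ : ∀ k, AEStronglyMeasurable (φ k) μ)
    (hψ : ∀ k, AEStronglyMeasurable (ψ k) μ)
    (hφf : Tendsto (fun k => eLpNorm (fun x => φ k x - f x) 2 μ) atTop (𝓝 0))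
    (hψg : Tendsto (fun k => eLpNorm (fun x => ψ k x - g x) 2 μ) atTop (𝓝 0))
    (h : ∀ k, eLpNorm (fun x => w x * φ k x) 2 μ ≤ C * eLpNorm (ψ k) 2 μ) :
    eLpNorm (fun x => w x * f x) 2 μ ≤ C * eLpNorm g 2 μ := by
  obtain ⟨ns, hns, hae⟩ :=
    (tendstoInMeasure_of_tendsto_eLpNorm two_ne_zero hφ hf hφf).exists_seq_tendsto_ae
  have hfatou := Lp.eLpNorm_lim_le_liminf_eLpNorm (p := 2)
    (f := fun k x => w x * φ (ns k) x) (fun k => hw.mul (hφ _)) (fun x => w x * f x)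
    (hae.mono fun x hx => hx.const_mul (w x))
  refine hfatou.trans ?_
  have hlim : Tendsto (fun k => C * (eLpNorm (fun x => ψ (ns k) x - g x) 2 μ + eLpNorm g 2 μ))
      atTop (𝓝 (C * (0 + eLpNorm g 2 μ))) :=
    ENNReal.Tendsto.const_mul ((hψg.comp hns.tendsto_atTop).add tendsto_const_nhds)
      (Or.inr ENNReal.coe_ne_top)
  rw [zero_add] at hlim
  rw [← hlim.liminf_eq]
  refine liminf_le_liminf (Eventually.of_forall fun k => (h _).trans ?_)
  gcongr
  have := eLpNorm_add_le ((hψ (ns k)).sub hg) hg (p := 2) one_le_two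
  rwa [sub_add_cancel] at this

end BoundaryLayerHardy

open BoundaryLayerHardy in
theorem mainTheorem2 (n : ℕ) (hn : 1 ≤ n) (U : Set (BoundaryLayerHardy.E n)) (hUo : IsOpen U)
    (hUb : Bornology.IsBounded U) (hU2 : BoundaryLayerHardy.HasC2Boundary U) :
    ∃ ε₀ : ℝ, 0 < ε₀ ∧ ∃ C : ℝ, 0 < C ∧ ∀ ε : ℝ, 0 < ε → ε < ε₀ →
      ∀ (f : BoundaryLayerHardy.E n → ℝ) (g : BoundaryLayerHardy.E n → BoundaryLayerHardy.E n),
        BoundaryLayerHardy.MemH10 U f → BoundaryLayerHardy.HasWeakGradient U f g →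
          IntegrableOn (fun x => |f x| ^ 2 / Metric.infDist x (frontier U) ^ 2)
            (BoundaryLayerHardy.boundaryLayer U ε) ∧
          ∫ x in BoundaryLayerHardy.boundaryLayer U ε,
              |f x| ^ 2 / Metric.infDist x (frontier U) ^ 2 ≤
            C * ∫ x in BoundaryLayerHardy.boundaryLayer U ε, ‖g x‖ ^ 2 := by
  obtain ⟨ε₀, hε₀, C, hC⟩ := exists_lintegral_hardy hn hUo hUb hU2
  -- `C` may be zero, whereas the constant has to be positive.
  refine ⟨ε₀, hε₀, C + 1, by positivity,
    fun ε _ hε f g ⟨hfL, g₀, hg₀L, hg₀, φ, hφ, hφf, hφg⟩ hg => ?_⟩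
  set μ := volume.restrict (boundaryLayer U ε) with hμ
  set w : E n → ℝ := fun x => (Metric.infDist x (frontier U))⁻¹ with hw
  have hle : μ ≤ volume.restrict U := Measure.restrict_mono_set _ fun x hx => hx.1
  have hgg : g₀ =ᵐ[volume.restrict U] g := hg₀.ae_eq hUo hg
  have hgL : MemLp g 2 μ := (hg₀L.ae_eq hgg).mono_measure hle
  have hwm : Measurable w := (Metric.continuous_infDist_pt _).measurable.inv
  have hfm : AEStronglyMeasurable f μ := (hfL.mono_measure hle).1
  have hC1 : ∀ k, Continuous (φ k) ∧ Continuous (gradient (φ k)) := fun k =>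
    ⟨(hφ k).contDiff.continuous, (InnerProductSpace.toDual ℝ (E n)).symm.continuous.comp
      ((hφ k).contDiff.continuous_fderiv (by simp))⟩
  have hsq : ∀ (u : E n → ℝ) x,
      ‖w x * u x‖ ^ 2 = |u x| ^ 2 / Metric.infDist x (frontier U) ^ 2 := fun u x => by
    rw [Real.norm_eq_abs, sq_abs, sq_abs, hw, mul_pow, inv_pow]; ring
  have hψg : Tendsto (fun k => eLpNorm (fun x => gradient (φ k) x - g x) 2 μ) atTop (𝓝 0) := by
    refine tendsto_of_tendsto_of_tendsto_of_le_of_le tendsto_const_nhds hφg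
      (fun _ => zero_le) fun k => (eLpNorm_mono_measure _ hle).trans_eq
        (eLpNorm_congr_ae ?_)
    filter_upwards [hgg] with x hx
    rw [hx]
  have hfinal : eLpNorm (fun x => w x * f x) 2 μ ≤ NNReal.sqrt C * eLpNorm g 2 μ := by
    refine eLpNorm_mul_le_of_tendsto hwm.aestronglyMeasurable hfm hgL.1
      (fun k => (hC1 k).1.aestronglyMeasurable) (fun k => (hC1 k).2.aestronglyMeasurable)
      (tendsto_of_tendsto_of_tendsto_of_le_of_le tendsto_const_nhds hφf
        (fun _ => zero_le) fun k => eLpNorm_mono_measure _ hle) hψg fun k => ?_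
    rw [← ENNReal.pow_le_pow_left_iff two_ne_zero, mul_pow, eLpNorm_two_pow_two,
      eLpNorm_two_pow_two, ← ENNReal.coe_pow, NNReal.sq_sqrt]
    simp only [hsq, sq_abs]
    exact hC ε hε (φ k) (hφ k)
  have hmem : MemLp (fun x => w x * f x) 2 μ :=
    ⟨hwm.aestronglyMeasurable.mul hfm,
      hfinal.trans_lt (ENNReal.mul_lt_top ENNReal.coe_lt_top hgL.2)⟩
  have hI := hmem.integrable_norm_pow two_ne_zero
  have hIg := hgL.integrable_norm_pow two_ne_zero
  simp only [hsq] at hI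
  refine ⟨hI, ?_⟩
  have hpow := pow_le_pow_left' hfinal 2
  rw [mul_pow, eLpNorm_two_pow_two, eLpNorm_two_pow_two, ← ENNReal.coe_pow, NNReal.sq_sqrt] at hpow
  simp only [hsq] at hpow
  rw [← ofReal_integral_eq_lintegral_ofReal hI (ae_of_all _ fun x => by positivity),
    ← ofReal_integral_eq_lintegral_ofReal hIg (ae_of_all _ fun x => by positivity),
    ← ENNReal.ofReal_coe_nnreal, ← ENNReal.ofReal_mul C.coe_nonneg] at hpow
  have hnn : 0 ≤ ∫ x, ‖g x‖ ^ 2 ∂μ := integral_nonneg fun x => by positivity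
  have := (ENNReal.ofReal_le_ofReal_iff (mul_nonneg C.coe_nonneg hnn)).1 hpow
  exact this.trans (by gcongr; linarith)
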